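/- Let $(X,\mu)$ and $(Y,\nu)$ be standard atomless probability spaces (Lebesgue--Rokhlin spaces isomorphic to $[0,1]$ with Lebesgue measure); measurability refers to the completed measures. Definitions. A semimetric $\rho$ on a measure space $(Z,\lambda)$ is \emph{admissible} if it is measurable as a function of two variables on $Z\times Z$ and there is a set $Z_0\subset Z$ of full measure such that $(Z_0,\rho)$ is separable. A measurable function $g:X\times Y\to\mathbb R$ is \emph{properly virtually continuous} if for every $\varepsilon>0$ there are measurable sets $X'\subset X$, $Y'\subset Y$, each of measure at least $1-\varepsilon$, and admissible semimetrics $\rho_X$ on $X'$ and $\rho_Y$ on $Y'$ (with the restricted measures) such that $g$ is continuous on $X'\times Y'$ with the product topology of $\rho_X$ and $\rho_Y$. A function is \emph{virtually continuous} if it coincides $\mu\times\nu$-almost everywhere with a properly virtually continuous function. Theorem. Let $f:X\times Y\to\mathbb R$ be measurable, and let $x_1,x_2,\dots$ and $y_1,y_2,\dots$ be jointly independent random points, each $x_s$ having law $\mu$ in $X$ and each $y_t$ having law $\nu$ in $Y$. Then $f$ is virtually continuous if and only if (i) holds, and $f$ is virtually continuous if and only if (ii) holds, where: (i) For every $\varepsilon>0$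 there is a positive integer $N$ such that the probability of the following event tends to $1$ as $n\to\infty$: there exist partitions $\{1,\dots,n\}=\bigsqcup_{i=0}^N A_i=\bigsqcup_{j=0}^N B_j$ (parts may be empty) such that $|A_0|<\varepsilon n$, $|B_0|<\varepsilon n$, and $|f(x_s,y_t)-f(x_r,y_p)|<\varepsilon$ whenever $1\le i,j\le N$, $s,r\in A_i$ and $t,p\in B_j$. (ii) For every $\varepsilon>0$ there is a positive integer $N$ such that with probability $1$ there exist partitions $\{1,2,\dots\}=\bigsqcup_{i=0}^N A_i=\bigsqcup_{j=0}^N B_j$ (parts may be empty) such that $\limsup_{n\to\infty}|(A_0\cup B_0)\cap\{1,\dots,n\}|/n<\varepsilon$ and $|f(x_s,y_t)-f(x_r,y_p)|<\varepsilon$ whenever $1\le i,j\le N$, $s,r\in A_i$ and $t,p\in B_j$. -/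

import Mathlib

open MeasureTheory ProbabilityTheory Filter Topology

/-- A semimetric `ρ` on a measure space `(X, μ)` is admissible if it is measurable as a function of
two variables and some set `X₀` of full measure is separable for `ρ`.
Measurability is meant with respect to the completed product measure, i.e. `AEMeasurable`. -/
def IsAdmissible {X : Type*} [MeasurableSpace X] (μ : Measure X) (ρ : PseudoMetricSpace X) :
    Prop :=
  AEMeasurable (fun p : X × X => ρ.dist p.1 p.2) (μ.prod μ) ∧
    ∃ X₀ : Set X, μ X₀ᶜ = 0 ∧ TopologicalSpace.IsSeparable X₀

/-- A measurable function `f` on `X × Y` is properly virtually continuous if for every `ε > 0` there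
are measurable sets `X' ⊆ X`, `Y' ⊆ Y` of measure at least `1 - ε` and admissible semimetrics on
`X'` and `Y'` for which `f` is (jointly) continuous on `X' × Y'`.
The subset `X'` carries the restricted measure `μ.comap Subtype.val`; measurability of functions and
sets is with respect to the completed measures. -/
def ProperlyVirtuallyContinuous {X Y : Type*} [MeasurableSpace X] [MeasurableSpace Y]
    (μ : Measure X) (ν : Measure Y) (f : X × Y → ℝ) : Prop :=
  AEMeasurable f (μ.prod ν) ∧
    ∀ ε : ℝ, 0 < ε → ∃ (X' : Set X) (Y' : Set Y),
      NullMeasurableSet X' μ ∧ NullMeasurableSet Y' ν ∧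
      1 - ε ≤ μ.real X' ∧ 1 - ε ≤ ν.real Y' ∧
      ∃ (ρX : PseudoMetricSpace X') (ρY : PseudoMetricSpace Y'),
        IsAdmissible (μ.comap (Subtype.val : X' → X)) ρX ∧
        IsAdmissible (ν.comap (Subtype.val : Y' → Y)) ρY ∧
        Continuous (fun p : X' × Y' => f (p.1, p.2))

/-- A function is virtually continuous if it coincides almost everywhere with a properly virtually
continuous function. -/
def VirtuallyContinuous {X Y : Type*} [MeasurableSpace X] [MeasurableSpace Y]
    (μ : Measure X) (ν : Measure Y) (f : X × Y → ℝ) : Prop :=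
  ∃ g : X × Y → ℝ, ProperlyVirtuallyContinuous μ ν g ∧ f =ᵐ[μ.prod ν] g

/-- Partitions of the index set `ι` into `N + 1` (possibly empty) parts `A₀, …, A_N` and
`B₀, …, B_N` are given by labellings `a`, `b`, that is `A_i = {s | a s = i}`, `B_j = {t | b t = j}`.
The matrix `m` varies by less than `ε` on each block `A_i × B_j` with `i, j > 0`. -/
def VariesLessOnBlocks {ι : Type*} {N : ℕ} (m : ι → ι → ℝ) (a b : ι → Fin (N + 1)) (ε : ℝ) :
    Prop :=
  ∀ i j : Fin (N + 1), 0 < i → 0 < j →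
    ∀ s r t p : ι, a s = i → a r = i → b t = j → b p = j → |m s t - m r p| < ε

/-- The `n × n` matrix `m` admits partitions of its rows and of its columns with exceptional parts
`A₀`, `B₀` of fewer than `ε n` elements and `N` other parts such that `m` varies by less than `ε`
on each non-exceptional block. -/
def FiniteBlockStructure (ε : ℝ) (N n : ℕ) (m : Fin n → Fin n → ℝ) : Prop :=
  ∃ a b : Fin n → Fin (N + 1),
    ((Finset.univ.filter fun s => a s = 0).card : ℝ) < ε * n ∧
    ((Finset.univ.filter fun t => b t = 0).card : ℝ) < ε * n ∧
    VariesLessOnBlocks m a b ε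

/-- The infinite matrix `m` admits partitions of its rows and of its columns such that `A₀ ∪ B₀` has
upper density less than `ε` and `m` varies by less than `ε` on each non-exceptional block. -/
def InfiniteBlockStructure (ε : ℝ) (N : ℕ) (m : ℕ → ℕ → ℝ) : Prop :=
  ∃ a b : ℕ → Fin (N + 1),
    limsup (fun n : ℕ =>
      (((Finset.range n).filter fun k => a k = 0 ∨ b k = 0).card : ℝ) / n) atTop < ε ∧
    VariesLessOnBlocks m a b ε

/-! The implications run from virtual continuity to (ii), from (ii) to (i), and from (i) back to
virtual continuity. The pivot is a deterministic statement: at every scale, each space splits into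
finitely many measurable cells and a small remainder, with `f` almost everywhere nearly constant on
products of cells.

Forward, a Lusin argument makes an admissible semimetric compact on nearly all of its domain
(`IsAdmissible.exists_isCompact`). A finite cover by rectangles of small oscillation gives the cells
(`ProperlyVirtuallyContinuous.exists_labels`), and the law of large numbers transfers them to the
sample. Truncating the infinite matrix gives (i).

Backward, fix one sample whose finite matrices have block structure infinitely often and whose
empirical measures converge. Attaching the row and column labels gives empirical measures on
labelled points, which converge weakly along a subsequence. The limit is only a fractional
labelling; `exists_label_absolutelyContinuous` rounds it to a genuine one. Weak limits control open
sets, while `f` is merely measurable, so countably many sets defined by `f` are enlarged to open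
sets whose excess is also small for the sampled product measures (`exists_open_approx_sample`).
Hence "this block misses this set" survives the limit (`exists_labels_of_weak_limit`).

Cells at scales `2⁻ⁿ` then give step functions converging to `f` almost everywhere. Off a small set
of points, their convergence is uniform, so the limit is continuous for semimetrics read off from
the label sequences (`virtuallyContinuous_of_step_approx`). -/

/-! ### Admissible semimetrics, compactness and finite labellings -/

theorem Measurable.exists_polish_borel_continuous {X β : Type*} [MeasurableSpace X]
    [StandardBorelSpace X] [TopologicalSpace β] [MeasurableSpace β] [OpensMeasurableSpace β]
    [SecondCountableTopology β] {R : X → β} (hR : Measurable R) :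
    ∃ _ : TopologicalSpace X, PolishSpace X ∧ BorelSpace X ∧ Continuous R := by
  let := upgradeStandardBorel X
  have hX : PolishSpace X := inferInstance
  obtain ⟨τ, hτ, hRc, hpol⟩ := hR.exists_continuous
  refine ⟨τ, hpol, ?_, hRc⟩
  have h := borel_eq_borel_of_le hpol hX hτ
  exact @BorelSpace.mk X τ _ (by rw [h]; exact BorelSpace.measurable_eq)

-- Distances to a countable dense set determine the semimetric topology. Once these countably many
-- functions are continuous on a compact set `K`, the inclusion of `K` is continuous for `ρ`, so `K`
-- is `ρ`-compact and `ρ`-open sets have Borel traces on it.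
open Set in
theorem IsAdmissible.exists_isCompact {X : Type*} [MeasurableSpace X] [StandardBorelSpace X]
    (μ : Measure X) [IsFiniteMeasure μ] {S : Set X} (hS : NullMeasurableSet S μ)
    {ρ : PseudoMetricSpace S} (hρ : IsAdmissible (μ.comap (Subtype.val : S → X)) ρ)
    {δ : ENNReal} (hδ : δ ≠ 0) :
    ∃ K : Set X, MeasurableSet K ∧ K ⊆ S ∧ μ S < μ K + δ ∧
      IsCompact (Subtype.val ⁻¹' K : Set S) ∧
      ∀ V : Set S, IsOpen V → MeasurableSet (Subtype.val '' V ∩ K) := by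
  obtain ⟨hmeas, S₀, hS₀, hsep⟩ := hρ
  set μ' := μ.comap (Subtype.val : S → X) with hμ'
  have himg : ∀ s : Set S, MeasurableSet s → NullMeasurableSet (Subtype.val '' s) μ :=
    fun s hs => Measure.MeasurableSet.nullMeasurableSet_subtype_coe hS hs
  have hfin : IsFiniteMeasure μ' := by
    refine ⟨?_⟩
    rw [hμ', Measure.comap_apply₀ _ _ Subtype.coe_injective himg MeasurableSet.univ.nullMeasurableSet]
    exact measure_lt_top _ _
  have hgood : ∀ᵐ x ∂μ', AEMeasurable (fun y => ρ.dist x y) μ' := by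
    filter_upwards [hmeas.aestronglyMeasurable.prodMk_left] with x hx using hx.aemeasurable
  set S₁ : Set S := S₀ ∩ {x | AEMeasurable (fun y => ρ.dist x y) μ'}
  have hS₁ : ∀ᵐ x ∂μ', x ∈ S₁ := by
    filter_upwards [hgood, (mem_ae_iff.2 hS₀ : S₀ ∈ ae μ')] with x h1 h2 using ⟨h2, h1⟩
  obtain ⟨D, hDS, hDc, hDd⟩ : ∃ D ⊆ S₁, D.Countable ∧ S₁ ⊆ closure D :=
    (hsep.mono inter_subset_left).exists_countable_dense_subset
  have := hDc.to_subtype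
  have hDm : ∀ d : D, AEMeasurable (fun y => ρ.dist d.1 y) μ' := fun d => (hDS d.2).2
  choose u hu hue using hDm
  have hext : ∀ d : D, ∃ r : X → ℝ, Measurable r ∧ u d = r ∘ Subtype.val :=
    fun d => (hu d).exists_eq_measurable_comp
  choose r hr hur using hext
  -- Points where all the Borel representatives `r d` agree with the true distances, so that on `T`
  -- the semimetric is governed by Borel functions.
  set T : Set S := {x | x ∈ S₁ ∧ ∀ d : D, ρ.dist d.1 x = r d x}
  have hT : ∀ᵐ x ∂μ', x ∈ T := by
    filter_upwards [hS₁, ae_all_iff.2 hue] with x h1 h2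
    refine ⟨h1, fun d => ?_⟩
    have := h2 d
    rw [hur d] at this
    exact this
  have hTS : (Subtype.val '' T : Set X) =ᵐ[μ] S := by
    refine (Subtype.coe_image_subset S T).eventuallyLE.antisymm ?_
    have h0 : μ (Subtype.val '' Tᶜ) = 0 :=
      Measure.measure_subtype_coe_eq_zero_of_comap_eq_zero hS hT
    filter_upwards [mem_ae_iff.2 ((compl_compl (Subtype.val '' Tᶜ : Set X)).symm ▸ h0)] with x hx hxS
    by_contra hn
    exact hx ⟨⟨x, hxS⟩, fun h => hn ⟨_, h, rfl⟩, rfl⟩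
  obtain ⟨B, hBT, hB, hBe⟩ := (hS.congr hTS.symm).exists_measurable_subset_ae_eq
  have hBS : μ B = μ S := measure_congr (hBe.trans hTS)
  let R : X → D → ℝ := fun x d => r d x
  have hR : Measurable R := measurable_pi_iff.2 hr
  -- Refining the Polish topology makes every `r d` continuous without changing the Borel sets, so
  -- inner regularity by compact sets remains available.
  obtain ⟨τ, hpol, hborel, hRc⟩ := hR.exists_polish_borel_continuous
  obtain ⟨K, hKB, hK, hlt⟩ := hB.exists_isCompact_lt_add (measure_ne_top μ B) hδ
  have hKm : MeasurableSet K := hK.measurableSet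
  have hBS' : B ⊆ S := hBT.trans (Subtype.coe_image_subset S T)
  have hKS : K ⊆ S := hKB.trans hBS'
  have key : ∀ V : Set S, IsOpen[ρ.toUniformSpace.toTopologicalSpace] V → ∀ x : X, x ∈ Subtype.val '' V ∩ K →
      ∃ O : Set X, IsOpen O ∧ x ∈ O ∧ O ∩ K ⊆ Subtype.val '' V := by
    rintro V hV _ ⟨⟨v, hvV, rfl⟩, hvK⟩
    have hT' : ∀ w : S, (w : X) ∈ K → w ∈ T := fun w hw => by
      obtain ⟨w', hw', he⟩ := hBT (hKB hw)
      rwa [← Subtype.ext he]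
    obtain ⟨e, he, hball⟩ := Metric.isOpen_iff.1 hV v hvV
    obtain ⟨d, hdD, hd⟩ := Metric.mem_closure_iff.1 (hDd (hT' v hvK).1) (e / 2) (half_pos he)
    refine ⟨{z | R z ⟨d, hdD⟩ < e / 2},
      isOpen_lt ((continuous_apply _).comp hRc) continuous_const, ?_, ?_⟩
    · have h := (hT' v hvK).2 ⟨d, hdD⟩
      change r _ _ < _
      rw [← h]
      exact (dist_comm d v).trans_lt hd
    · rintro z ⟨hz, hzK⟩
      refine ⟨⟨z, hKS hzK⟩, hball ?_, rfl⟩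
      have h := (hT' ⟨z, hKS hzK⟩ hzK).2 ⟨d, hdD⟩
      change r _ _ < _ at hz
      rw [← h] at hz
      change dist d _ < _ at hz
      rw [Metric.mem_ball, dist_comm]
      linarith [dist_triangle v d ⟨z, hKS hzK⟩]
  refine ⟨K, hKm, hKS, hBS ▸ hlt, ?_, fun V hV => ?_⟩
  · have hc : @Continuous K S _ ρ.toUniformSpace.toTopologicalSpace (inclusion hKS) := by
      refine continuous_def.2 fun V hV => isOpen_iff_mem_nhds.2 fun x hx => ?_
      obtain ⟨O, hO, hxO, hOV⟩ := key V hV x ⟨⟨_, hx, rfl⟩, x.2⟩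
      filter_upwards [(hO.preimage continuous_subtype_val).mem_nhds hxO] with z hz
      obtain ⟨w, hw, hwz⟩ := hOV ⟨hz, z.2⟩
      have : inclusion hKS z = w := Subtype.ext hwz.symm
      simpa [this] using hw
    have := isCompact_iff_compactSpace.1 hK
    have hr : Subtype.val ⁻¹' K = range (inclusion hKS) := (range_inclusion hKS).symm
    rw [hr]
    exact @isCompact_range K S _ ρ.toUniformSpace.toTopologicalSpace _ _ hc
  · have : Subtype.val '' V ∩ K = ⋃₀ {O | IsOpen O ∧ O ∩ K ⊆ Subtype.val '' V} ∩ K := by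
      ext x
      refine ⟨fun hx => ?_, fun ⟨⟨O, hO, hxO⟩, hxK⟩ => ⟨hO.2 ⟨hxO, hxK⟩, hxK⟩⟩
      obtain ⟨O, h1, h2, h3⟩ := key V hV x hx
      exact ⟨⟨O, ⟨h1, h3⟩, h2⟩, hx.2⟩
    rw [this]
    exact (isOpen_sUnion fun O hO => hO.1).measurableSet.inter hKm

theorem measurable_of_finite_family {X κ β : Type*} [MeasurableSpace X] [Finite κ]
    [MeasurableSpace β] (U : κ → Set X) (hU : ∀ k, MeasurableSet (U k)) (F : (κ → Prop) → β) :
    Measurable fun x => F fun k => x ∈ U k := by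
  let : MeasurableSpace (κ → Prop) := ⊤
  have hl : Measurable fun x => (fun k => x ∈ U k : κ → Prop) := by
    have h : @Measurable X (κ → Prop) _ MeasurableSpace.pi (fun x k => x ∈ U k) :=
      measurable_pi_iff.2 fun k => measurable_mem.2 (hU k)
    refine measurable_to_countable' fun p => h ?_
    exact @MeasurableSet.singleton (κ → Prop) MeasurableSpace.pi _ p
  exact measurable_from_top.comp hl

open Set in
/-- Finitely many sets, traced on `K`, generate a measurable labelling that is nonzero on `K`. -/
theorem exists_measurable_label {X κ : Type*} [MeasurableSpace X] [Fintype κ] {N : ℕ}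
    (e : (κ → Prop) ≃ Fin N) {K : Set X} (hK : MeasurableSet K) (U : κ → Set X)
    (hU : ∀ k, MeasurableSet (U k)) :
    ∃ a : X → Fin (N + 1), Measurable a ∧ a ⁻¹' {0} = Kᶜ ∧
      ∀ x x', a x ≠ 0 → a x = a x' → ∀ k, x ∈ U k → x' ∈ U k := by
  classical
  refine ⟨fun x => if x ∈ K then (e fun k => x ∈ U k).succ else 0, ?_, ?_, ?_⟩
  · exact Measurable.ite hK (measurable_of_finite_family U hU fun p => (e p).succ)
      measurable_const
  · ext x
    by_cases hx : x ∈ K <;> simp [hx]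
  · intro x x' hx hxx' k hk
    by_cases h : x ∈ K <;> by_cases h' : x' ∈ K <;> simp [h, h'] at hx hxx'
    · exact (iff_of_eq (congrFun hxx' k)).1 hk

theorem measureReal_compl_lt_of_lt_add {Z : Type*} [MeasurableSpace Z] {m : Measure Z}
    [IsProbabilityMeasure m] {A C : Set Z} {δ : ℝ} (hδ : 0 ≤ δ) (h₁ : 1 - δ ≤ m.real A)
    (h₂ : m A < m C + ENNReal.ofReal δ) (hC : MeasurableSet C) : m.real Cᶜ < 2 * δ := by
  rw [probReal_compl_eq_one_sub hC]
  have := (ENNReal.toReal_lt_toReal (by finiteness) (by finiteness)).2 h₂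
  rw [ENNReal.toReal_add (by finiteness) (by finiteness), ENNReal.toReal_ofReal hδ] at this
  change m.real A < m.real C + δ at this
  linarith

open Set in
theorem ProperlyVirtuallyContinuous.exists_labels {X Y : Type*} [MeasurableSpace X]
    [StandardBorelSpace X] [MeasurableSpace Y] [StandardBorelSpace Y]
    {μ : Measure X} [IsProbabilityMeasure μ] {ν : Measure Y} [IsProbabilityMeasure ν]
    {g : X × Y → ℝ} (hg : ProperlyVirtuallyContinuous μ ν g) {ε : ℝ} (hε : 0 < ε) :
    ∃ N : ℕ, 0 < N ∧ ∃ (a : X → Fin (N + 1)) (b : Y → Fin (N + 1)), Measurable a ∧ Measurable b ∧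
      μ.real (a ⁻¹' {0}) < ε ∧ ν.real (b ⁻¹' {0}) < ε ∧
      ∀ x x' y y', a x ≠ 0 → b y ≠ 0 → a x = a x' → b y = b y' → |g (x, y) - g (x', y')| < ε := by
  obtain ⟨-, hg⟩ := hg
  -- Half of `ε` pays for leaving the domains of the semimetrics, the other half for passing to
  -- compact subsets.
  obtain ⟨S, T, hS, hT, hμS, hνT, ρX, ρY, hρX, hρY, hc⟩ := hg (ε / 2) (half_pos hε)
  have hε4 : ENNReal.ofReal (ε / 2) ≠ 0 := by simpa using hε
  obtain ⟨K, hK, hKS, hKμ, hKc, hKV⟩ := hρX.exists_isCompact μ hS hε4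
  obtain ⟨L, hL, hLT, hLν, hLc, hLV⟩ := hρY.exists_isCompact ν hT hε4
  have hnhds : ∀ p : S × T, ∃ (U : Set S) (V : Set T), IsOpen U ∧ IsOpen V ∧ p.1 ∈ U ∧ p.2 ∈ V ∧
      ∀ q ∈ U ×ˢ V, |g (q.1, q.2) - g (p.1, p.2)| < ε / 2 := by
    intro p
    have : {q : S × T | |g (q.1, q.2) - g (p.1, p.2)| < ε / 2} ∈ 𝓝 p :=
      Metric.continuousAt_iff'.1 hc.continuousAt _ (half_pos hε)
    obtain ⟨U, V, hU, hpU, hV, hpV, h⟩ := mem_nhds_prod_iff'.1 this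
    exact ⟨U, V, hU, hV, hpU, hpV, fun q hq => h hq⟩
  choose U V hU hV hpU hpV hosc using hnhds
  obtain ⟨t, ht⟩ := (hKc.prod hLc).elim_nhds_subcover' (fun p _ => U p ×ˢ V p)
    (fun p _ => ((hU p).prod (hV p)).mem_nhds ⟨hpU p, hpV p⟩)
  classical
  have := Fintype.ofFinite (t → Prop)
  let e := Fintype.equivFin (t → Prop)
  -- Labels are the atoms generated by the sides of the finite cover: replacing a point by another
  -- in its atom never leaves a rectangle of the cover.
  obtain ⟨a, ha, ha0, haU⟩ := exists_measurable_label e hK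
    (fun p : t => Subtype.val '' U p.1 ∩ K) fun p => hKV _ (hU _)
  obtain ⟨b, hb, hb0, hbV⟩ := exists_measurable_label e hL
    (fun p : t => Subtype.val '' V p.1 ∩ L) fun p => hLV _ (hV _)
  refine ⟨_, Fintype.card_pos, a, b, ha, hb, ?_, ?_, fun x x' y y' hx hy hxx hyy => ?_⟩
  · rw [ha0, ← mul_div_cancel₀ ε two_ne_zero]
    exact measureReal_compl_lt_of_lt_add (half_pos hε).le hμS hKμ hK
  · rw [hb0, ← mul_div_cancel₀ ε two_ne_zero]
    exact measureReal_compl_lt_of_lt_add (half_pos hε).le hνT hLν hL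
  · have hxK : x ∈ K := by
      by_contra h
      exact hx (ha0.symm.subset h)
    have hyL : y ∈ L := by
      by_contra h
      exact hy (hb0.symm.subset h)
    obtain ⟨p, hpt, hp⟩ := mem_iUnion₂.1
      (ht (show ((⟨x, hKS hxK⟩, ⟨y, hLT hyL⟩) : S × T) ∈ _ from ⟨hxK, hyL⟩))
    obtain ⟨⟨u, hu, rfl⟩, -⟩ := haU x x' hx hxx ⟨p, hpt⟩ ⟨⟨_, hp.1, rfl⟩, hxK⟩
    obtain ⟨⟨v, hv, rfl⟩, -⟩ := hbV y y' hy hyy ⟨p, hpt⟩ ⟨⟨_, hp.2, rfl⟩, hyL⟩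
    have h₁ := hosc p _ hp
    have h₂ := hosc p (u, v) ⟨hu, hv⟩
    rw [abs_lt] at h₁ h₂ ⊢
    simp only at h₁ h₂
    constructor <;> linarith

/-! ### Sampling a labelling, and restricting infinite matrices to finite ones -/

/-- The tail intersections increase to a set of full measure. Continuity from below needs no
measurability of the events. -/
theorem tendsto_measure_of_ae_eventually {Ω : Type*} [MeasurableSpace Ω] {P : Measure Ω}
    [IsProbabilityMeasure P] {E : ℕ → Set Ω} (h : ∀ᵐ ω ∂P, ∀ᶠ n in atTop, ω ∈ E n) :
    Tendsto (fun n => P (E n)) atTop (𝓝 1) := by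
  have hmono : Monotone fun n => ⋂ k ≥ n, E k := fun m n hmn =>
    Set.biInter_mono (fun k hk => le_trans hmn hk) fun _ _ => le_rfl
  have hU : P (⋃ n, ⋂ k ≥ n, E k) = 1 := by
    rw [← measure_univ (μ := P)]
    refine measure_congr (eventuallyEq_univ.2 ?_)
    filter_upwards [h] with ω hω
    obtain ⟨n, hn⟩ := eventually_atTop.1 hω
    exact Set.mem_iUnion.2 ⟨n, Set.mem_iInter₂.2 hn⟩
  refine tendsto_of_tendsto_of_tendsto_of_le_of_le (hU ▸ tendsto_measure_iUnion_atTop hmono)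
    tendsto_const_nhds (fun n => ?_) fun n => prob_le_one
  exact measure_mono (Set.biInter_subset_of_mem (le_refl n))

section Sampling

variable {X Y Ω : Type*} [MeasurableSpace X] [MeasurableSpace Y] [MeasurableSpace Ω]
  {μ : Measure X} {ν : Measure Y} {P : Measure Ω} [IsProbabilityMeasure P]
  {x : ℕ → Ω → X} {y : ℕ → Ω → Y}

theorem hasLaw_sample_pair (hx : ∀ i, HasLaw (x i) μ P) (hy : ∀ j, HasLaw (y j) ν P)
    (hxy_indep : IndepFun (fun ω i => x i ω) (fun ω j => y j ω) P) (s t : ℕ) :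
    HasLaw (fun ω => (x s ω, y t ω)) (μ.prod ν) P :=
  (hxy_indep.comp (measurable_pi_apply s) (measurable_pi_apply t)).hasLaw_prod (hx s) (hy t)

theorem ae_forall_sample_pair (hx : ∀ i, HasLaw (x i) μ P) (hy : ∀ j, HasLaw (y j) ν P)
    (hxy_indep : IndepFun (fun ω i => x i ω) (fun ω j => y j ω) P) {p : X × Y → Prop}
    (hp : ∀ᵐ z ∂μ.prod ν, p z) : ∀ᵐ ω ∂P, ∀ s t, p (x s ω, y t ω) := by
  refine ae_all_iff.2 fun s => ae_all_iff.2 fun t => ?_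
  have h := hasLaw_sample_pair hx hy hxy_indep s t
  rw [← h.map_eq] at hp
  exact ae_of_ae_map h.aemeasurable hp

open Classical in
theorem ae_tendsto_frequency (hx : ∀ i, HasLaw (x i) μ P) (hx_indep : iIndepFun x P)
    {A : Set X} (hA : MeasurableSet A) :
    ∀ᵐ ω ∂P, Tendsto (fun n : ℕ => (((Finset.range n).filter fun s => x s ω ∈ A).card : ℝ) / n)
      atTop (𝓝 (μ.real A)) := by
  have hm : Measurable (A.indicator fun _ => (1 : ℝ)) := measurable_const.indicator hA
  have hid : ∀ i, IdentDistrib (x i) (x 0) P P := fun i =>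
    ⟨(hx i).aemeasurable, (hx 0).aemeasurable, (hx i).map_eq.trans (hx 0).map_eq.symm⟩
  have := strong_law_ae_real (μ := P) (fun s ω => A.indicator (fun _ => (1 : ℝ)) (x s ω)) ?_ ?_ ?_
  · have hexp : ∫ ω, A.indicator (fun _ => (1 : ℝ)) (x 0 ω) ∂P = μ.real A := by
      rw [← integral_indicator_one hA]
      exact (hx 0).integral_comp hm.aestronglyMeasurable
    rw [hexp] at this
    filter_upwards [this] with ω hω
    refine hω.congr fun n => ?_
    simp [Set.indicator_apply]
  · refine Integrable.of_bound (C := 1)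
      (hm.comp_aemeasurable (hx 0).aemeasurable).aestronglyMeasurable (ae_of_all _ fun ω => ?_)
    by_cases h : x 0 ω ∈ A <;> simp [h]
  · exact fun i j hij => (hx_indep.indepFun hij).comp hm hm
  · exact fun i => (hid i).comp hm

end Sampling

theorem card_filter_fin_eq_card_filter_range (n : ℕ) (p : ℕ → Prop) [DecidablePred p] :
    (Finset.univ.filter fun s : Fin n => p s).card = ((Finset.range n).filter p).card := by
  simp only [Finset.card_filter]
  exact Fin.sum_univ_eq_sum_range (fun s => if p s then 1 else 0) n

theorem InfiniteBlockStructure.eventually_finiteBlockStructure {ε : ℝ} {N : ℕ} {m : ℕ → ℕ → ℝ}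
    (h : InfiniteBlockStructure ε N m) :
    ∀ᶠ n : ℕ in atTop, FiniteBlockStructure ε N n fun s t => m s t := by
  obtain ⟨a, b, hlim, hv⟩ := h
  have hb : IsBoundedUnder (· ≤ ·) atTop fun n : ℕ =>
      (((Finset.range n).filter fun k => a k = 0 ∨ b k = 0).card : ℝ) / n := by
    refine isBoundedUnder_of ⟨1, fun n => div_le_one_of_le₀ ?_ n.cast_nonneg⟩
    exact_mod_cast (Finset.card_filter_le _ _).trans (Finset.card_range n).le
  filter_upwards [eventually_lt_of_limsup_lt hlim hb, eventually_gt_atTop 0] with n hn hn0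
  rw [div_lt_iff₀ (by exact_mod_cast hn0)] at hn
  refine ⟨fun s => a s, fun t => b t, ?_, ?_,
    fun i j hi hj s r t p h₁ h₂ h₃ h₄ => hv i j hi hj s r t p h₁ h₂ h₃ h₄⟩
  · rw [card_filter_fin_eq_card_filter_range n fun s => a s = 0]
    refine lt_of_le_of_lt ?_ hn
    exact_mod_cast Finset.card_le_card (Finset.monotone_filter_right _ fun _ _ h => Or.inl h)
  · rw [card_filter_fin_eq_card_filter_range n fun s => b s = 0]
    refine lt_of_le_of_lt ?_ hn
    exact_mod_cast Finset.card_le_card (Finset.monotone_filter_right _ fun _ _ h => Or.inr h)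

theorem tendsto_finiteBlockStructure_of_ae {Ω : Type*} [MeasurableSpace Ω] {P : Measure Ω}
    [IsProbabilityMeasure P] {ε : ℝ} {N : ℕ} {m : Ω → ℕ → ℕ → ℝ}
    (h : ∀ᵐ ω ∂P, InfiniteBlockStructure ε N (m ω)) :
    Tendsto (fun n : ℕ => P {ω | FiniteBlockStructure ε N n fun s t => m ω s t}) atTop (𝓝 1) :=
  tendsto_measure_of_ae_eventually <| by
    filter_upwards [h] with ω hω using hω.eventually_finiteBlockStructure

theorem VirtuallyContinuous.ae_infiniteBlockStructure {X Y Ω : Type*} [MeasurableSpace X]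
    [StandardBorelSpace X] [MeasurableSpace Y] [StandardBorelSpace Y] [MeasurableSpace Ω]
    {μ : Measure X} [IsProbabilityMeasure μ] {ν : Measure Y} [IsProbabilityMeasure ν]
    {P : Measure Ω} [IsProbabilityMeasure P] {x : ℕ → Ω → X} {y : ℕ → Ω → Y}
    (hx : ∀ i, HasLaw (x i) μ P) (hy : ∀ j, HasLaw (y j) ν P)
    (hx_indep : iIndepFun x P) (hy_indep : iIndepFun y P)
    (hxy_indep : IndepFun (fun ω i => x i ω) (fun ω j => y j ω) P)
    {f : X × Y → ℝ} (hf : VirtuallyContinuous μ ν f) {ε : ℝ} (hε : 0 < ε) :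
    ∃ N : ℕ, 0 < N ∧
      ∀ᵐ ω ∂P, InfiniteBlockStructure ε N (fun s t : ℕ => f (x s ω, y t ω)) := by
  classical
  obtain ⟨g, hg, hfg⟩ := hf
  -- With `ε / 2` on each side, the two exceptional frequencies add up to less than `ε`, as required
  -- for the union.
  obtain ⟨N, hN, a, b, ha, hb, ha0, hb0, hab⟩ := hg.exists_labels (half_pos hε)
  refine ⟨N, hN, ?_⟩
  filter_upwards [ae_forall_sample_pair hx hy hxy_indep hfg,
    ae_tendsto_frequency hx hx_indep (ha (measurableSet_singleton 0)),
    ae_tendsto_frequency hy hy_indep (hb (measurableSet_singleton 0))] with ω hω hωa hωb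
  refine ⟨fun s => a (x s ω), fun t => b (y t ω), ?_,
    fun i j hi hj s r t p hs hr ht hp => ?_⟩
  · have hlim := hωa.add hωb
    refine lt_of_le_of_lt (limsup_le_limsup (Eventually.of_forall fun n => ?_) ?_
      hlim.isBoundedUnder_le) (hlim.limsup_eq.trans_lt (by linarith))
    · refine le_trans ?_ (add_div _ _ _).le
      refine div_le_div_of_nonneg_right ?_ n.cast_nonneg
      rw [Finset.filter_or]
      refine (Nat.cast_le.2 (Finset.card_union_le _ _)).trans (le_of_eq ?_)
      rw [Nat.cast_add]
      congr!
    · exact isCoboundedUnder_le_of_le atTop (x := 0) fun n => by positivity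
  · simp only [hω]
    refine (hab _ _ _ _ ?_ ?_ (hs.trans hr.symm) (ht.trans hp.symm)).trans (half_lt_self hε)
    · exact hs.trans_ne hi.ne'
    · exact ht.trans_ne hj.ne'

/-! ### Labelled measures: rounding and weak limits -/

/-- The part of a measure on labelled points carried by the label `i`. -/
noncomputable def MeasureTheory.Measure.labelPart {X κ : Type*} [MeasurableSpace X]
    [MeasurableSpace κ] (π : Measure (X × κ)) (i : κ) : Measure X :=
  (π.restrict (Set.univ ×ˢ {i})).map Prod.fst

section LabelPart

variable {X κ : Type*} [MeasurableSpace X] [MeasurableSpace κ]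

theorem MeasureTheory.Measure.labelPart_apply (π : Measure (X × κ)) (i : κ) {A : Set X}
    (hA : MeasurableSet A) : π.labelPart i A = π (A ×ˢ {i}) := by
  rw [labelPart, map_apply measurable_fst hA, restrict_apply (measurable_fst hA)]
  congr 1
  ext
  simp

instance (π : Measure (X × κ)) [IsFiniteMeasure π] (i : κ) : IsFiniteMeasure (π.labelPart i) := by
  unfold Measure.labelPart
  infer_instance

theorem MeasureTheory.Measure.labelPart_prod_apply {Y : Type*} [MeasurableSpace Y]
    (π : Measure (X × κ)) [IsFiniteMeasure π] (σ : Measure (Y × κ)) [IsFiniteMeasure σ] (i j : κ)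
    {Z : Set (X × Y)} (hZ : MeasurableSet Z) :
    ((π.labelPart i).prod (σ.labelPart j)) Z =
      (π.prod σ) {q | (q.1.1, q.2.1) ∈ Z ∧ q.1.2 = i ∧ q.2.2 = j} := by
  rw [labelPart, labelPart, map_prod_map _ _ measurable_fst measurable_fst, prod_restrict,
    map_apply (measurable_fst.prodMap measurable_fst) hZ,
    restrict_apply ((measurable_fst.prodMap measurable_fst) hZ)]
  congr 1
  ext
  simp [Prod.map]

theorem MeasureTheory.Measure.sum_labelPart_apply [Fintype κ] [MeasurableSingletonClass κ]
    (π : Measure (X × κ)) {A : Set X}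
    (hA : MeasurableSet A) : ∑ i, π.labelPart i A = π.map Prod.fst A := by
  simp_rw [labelPart_apply π _ hA]
  rw [map_apply measurable_fst hA, ← measure_biUnion_finset]
  · congr 1
    ext
    simp
  · intro i _ j _ hij
    exact Set.disjoint_left.2 fun q hq hq' => hij (hq.2.symm.trans hq'.2)
  · exact fun i _ => hA.prod (measurableSet_singleton i)

end LabelPart

/-- A measure on `X × Fin (N + 1)` with marginal `μ` is rounded to a labelling of `X`. -/
theorem exists_label_absolutelyContinuous {X : Type*} [MeasurableSpace X] {N : ℕ}
    {μ : Measure X} [IsFiniteMeasure μ] (π : Measure (X × Fin (N + 1))) [IsFiniteMeasure π]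
    (hπ : π.map Prod.fst = μ) :
    ∃ a : X → Fin (N + 1), Measurable a ∧ μ (a ⁻¹' {0}) ≤ π (Set.univ ×ˢ {0}) ∧
      ∀ i ≠ 0, μ.restrict (a ⁻¹' {i}) ≪ π.labelPart i := by
  classical
  have hle : ∀ i, π.labelPart i ≤ μ := fun i => Measure.le_iff.2 fun A hA => by
    rw [← hπ, ← π.sum_labelPart_apply hA]
    exact Finset.single_le_sum (f := fun i => π.labelPart i A) (fun _ _ => zero_le)
      (Finset.mem_univ i)
  have hac : ∀ i, π.labelPart i ≪ μ := fun i => (hle i).absolutelyContinuous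
  let S : Fin (N + 1) → Set X := fun i => {x | (π.labelPart i).rnDeriv μ x ≠ 0}
  have hS : ∀ i, MeasurableSet (S i) := fun i =>
    (Measure.measurable_rnDeriv _ _ (measurableSet_singleton 0)).compl
  have hwd : ∀ i, μ.withDensity ((π.labelPart i).rnDeriv μ) = π.labelPart i := fun i =>
    Measure.withDensity_rnDeriv_eq _ _ (hac i)
  -- Any nonzero label of positive density is chosen; `0` is used only where all nonzero labels have
  -- density zero, so there label `0` carries all of `μ`.
  let F : (Fin (N + 1) → Prop) → Fin (N + 1) := fun p =>
    if h : ∃ i ≠ 0, p i then h.choose else 0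
  have hF : ∀ x i, i ≠ 0 → (F fun k => x ∈ S k) = i → x ∈ S i := by
    intro x i hi h
    by_cases hp : ∃ i ≠ 0, x ∈ S i
    · have := hp.choose_spec
      simp only [F, dif_pos hp] at h
      exact h ▸ this.2
    · simp only [F, dif_neg hp] at h
      exact absurd h.symm hi
  have hF0 : ∀ x i, i ≠ 0 → (F fun k => x ∈ S k) = 0 → x ∉ S i := by
    intro x i hi h hx
    have hp : ∃ i ≠ 0, x ∈ S i := ⟨i, hi, hx⟩
    simp only [F, dif_pos hp] at h
    exact hp.choose_spec.1 h
  have hm : Measurable fun x => F fun k => x ∈ S k := measurable_of_finite_family S hS F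
  refine ⟨fun x => F fun k => x ∈ S k, hm, ?_, fun i hi => ?_⟩
  · have h0 := hm (measurableSet_singleton 0)
    rw [← π.labelPart_apply 0 MeasurableSet.univ]
    refine le_trans (le_of_eq ?_) (measure_mono (Set.subset_univ ((fun x => F fun k => x ∈ S k) ⁻¹' {0})))
    conv_lhs => rw [← hπ]
    rw [← π.sum_labelPart_apply h0]
    refine Finset.sum_eq_single 0 (fun i _ hi => ?_) (by simp)
    rw [← hwd i, withDensity_apply _ h0, setLIntegral_eq_zero_iff h0 (Measure.measurable_rnDeriv _ _)]
    refine ae_of_all _ fun x hx => not_not.1 (hF0 x i hi hx)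
  · refine Measure.AbsolutelyContinuous.trans ?_ (hwd i).absolutelyContinuous
    refine (Measure.absolutelyContinuous_of_le (Measure.restrict_mono
      (fun x hx => hF x i hi hx) le_rfl)).trans (?_ : μ.restrict (S i) ≪ _)
    refine (withDensity_absolutelyContinuous' (μ := μ.restrict (S i))
      (Measure.measurable_rnDeriv _ _).aemeasurable (ae_restrict_mem (hS i))).trans ?_
    rw [← restrict_withDensity (hS i)]
    exact Measure.restrict_le_self.absolutelyContinuous

/-- The portmanteau inequality bounds the limit mass of an open enlargement on a block by `δ k` when
`Z l` has no mass there infinitely often. Letting `k` grow makes the limit block null, and absolute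
continuity carries this to the rounded labels. -/
theorem exists_labels_of_weak_limit {X Y ι : Type*}
    [TopologicalSpace X] [PolishSpace X] [CompactSpace X] [MeasurableSpace X] [BorelSpace X]
    [TopologicalSpace Y] [PolishSpace Y] [CompactSpace Y] [MeasurableSpace Y] [BorelSpace Y]
    {μ : ProbabilityMeasure X} {ν : ProbabilityMeasure Y} {N : ℕ}
    {π : ℕ → ProbabilityMeasure (X × Fin (N + 1))} {σ : ℕ → ProbabilityMeasure (Y × Fin (N + 1))}
    (hπ : Tendsto (fun n => (π n).map measurable_fst.aemeasurable) atTop (𝓝 μ))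
    (hσ : Tendsto (fun n => (σ n).map measurable_fst.aemeasurable) atTop (𝓝 ν))
    {ε : ENNReal} (hπ₀ : ∀ n, (π n : Measure (X × Fin (N + 1))) (Set.univ ×ˢ {0}) ≤ ε)
    (hσ₀ : ∀ n, (σ n : Measure (Y × Fin (N + 1))) (Set.univ ×ˢ {0}) ≤ ε)
    {Z : ι → Set (X × Y)} (hZ : ∀ l, MeasurableSet (Z l)) {O : ι → ℕ → Set (X × Y)}
    (hO : ∀ l k, IsOpen (O l k)) (hZO : ∀ l k, Z l ⊆ O l k) {δ : ℕ → ENNReal}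
    (hδ : Tendsto δ atTop (𝓝 0))
    (hdiff : ∀ n l k, ((π n : Measure (X × Fin (N + 1))).prod (σ n : Measure (Y × Fin (N + 1))))
      {q | (q.1.1, q.2.1) ∈ O l k \ Z l} ≤ δ k) :
    ∃ (a : X → Fin (N + 1)) (b : Y → Fin (N + 1)), Measurable a ∧ Measurable b ∧
      (μ : Measure X) (a ⁻¹' {0}) ≤ ε ∧ (ν : Measure Y) (b ⁻¹' {0}) ≤ ε ∧
      ∃ φ : ℕ → ℕ, StrictMono φ ∧ ∀ i ≠ 0, ∀ j ≠ 0, ∀ l,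
        (∃ᶠ n in atTop, ((π (φ n) : Measure (X × Fin (N + 1))).prod
          (σ (φ n) : Measure (Y × Fin (N + 1))))
            {q | (q.1.1, q.2.1) ∈ Z l ∧ q.1.2 = i ∧ q.2.2 = j} = 0) →
        ((μ : Measure X).prod (ν : Measure Y)) (Z l ∩ (a ⁻¹' {i}) ×ˢ (b ⁻¹' {j})) = 0 := by
  have : SeqCompactSpace (ProbabilityMeasure (X × Fin (N + 1)) ×
    ProbabilityMeasure (Y × Fin (N + 1))) := FirstCountableTopology.seq_compact_of_compact
  obtain ⟨⟨p, r⟩, φ, hφ, hlim⟩ := SeqCompactSpace.tendsto_subseq fun n => (π n, σ n)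
  have hp : Tendsto (fun n => π (φ n)) atTop (𝓝 p) := (continuous_fst.tendsto _).comp hlim
  have hr : Tendsto (fun n => σ (φ n)) atTop (𝓝 r) := (continuous_snd.tendsto _).comp hlim
  have hpr : Tendsto (fun n => (π (φ n)).prod (σ (φ n))) atTop (𝓝 (p.prod r)) :=
    (ProbabilityMeasure.continuous_prod.tendsto (p, r)).comp hlim
  have hpμ : (p : Measure (X × Fin (N + 1))).map Prod.fst = (μ : Measure X) := by
    have h := ((ProbabilityMeasure.continuous_map continuous_fst).tendsto p).comp hp
    rw [← tendsto_nhds_unique h (hπ.comp hφ.tendsto_atTop)]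
    rfl
  have hrν : (r : Measure (Y × Fin (N + 1))).map Prod.fst = (ν : Measure Y) := by
    have h := ((ProbabilityMeasure.continuous_map continuous_fst).tendsto r).comp hr
    rw [← tendsto_nhds_unique h (hσ.comp hφ.tendsto_atTop)]
    rfl
  obtain ⟨a, ha, ha0, hac⟩ := exists_label_absolutelyContinuous (p : Measure (X × Fin (N + 1))) hpμ
  obtain ⟨b, hb, hb0, hbc⟩ := exists_label_absolutelyContinuous (r : Measure (Y × Fin (N + 1))) hrν
  refine ⟨a, b, ha, hb, ha0.trans ?_, hb0.trans ?_, φ, hφ, fun i hi j hj l hfreq => ?_⟩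
  · refine (ProbabilityMeasure.le_liminf_measure_open_of_tendsto hp
      (isOpen_univ.prod (isOpen_discrete {0}))).trans ?_
    exact (liminf_le_liminf (Eventually.of_forall fun n => hπ₀ (φ n))).trans
      (liminf_const ε).le
  · refine (ProbabilityMeasure.le_liminf_measure_open_of_tendsto hr
      (isOpen_univ.prod (isOpen_discrete {0}))).trans ?_
    exact (liminf_le_liminf (Eventually.of_forall fun n => hσ₀ (φ n))).trans
      (liminf_const ε).le
  · have hpart : ((p : Measure (X × Fin (N + 1))).labelPart i).prod ((r : Measure (Y × Fin (N + 1))).labelPart j) (Z l) = 0 := by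
      refine le_antisymm (ge_of_tendsto' hδ fun k => ?_) zero_le
      refine (measure_mono (hZO l k)).trans ?_
      rw [Measure.labelPart_prod_apply _ _ _ _ (hO l k).measurableSet]
      have hopen : IsOpen {q : (X × Fin (N + 1)) × (Y × Fin (N + 1)) |
          (q.1.1, q.2.1) ∈ O l k ∧ q.1.2 = i ∧ q.2.2 = j} := by
        refine ((hO l k).preimage (by fun_prop)).inter (IsOpen.inter ?_ ?_)
        · exact (isOpen_discrete {i}).preimage (by fun_prop : Continuous fun q :
            (X × Fin (N + 1)) × (Y × Fin (N + 1)) => q.1.2)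
        · exact (isOpen_discrete {j}).preimage (by fun_prop : Continuous fun q :
            (X × Fin (N + 1)) × (Y × Fin (N + 1)) => q.2.2)
      refine (ProbabilityMeasure.le_liminf_measure_open_of_tendsto hpr hopen).trans ?_
      refine liminf_le_of_frequently_le (hfreq.mono fun n hn => ?_)
      have hsub : {q : (X × Fin (N + 1)) × (Y × Fin (N + 1)) |
          (q.1.1, q.2.1) ∈ O l k ∧ q.1.2 = i ∧ q.2.2 = j} ⊆
          {q | (q.1.1, q.2.1) ∈ Z l ∧ q.1.2 = i ∧ q.2.2 = j} ∪
            {q | (q.1.1, q.2.1) ∈ O l k \ Z l} := by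
        intro q hq
        by_cases h : (q.1.1, q.2.1) ∈ Z l
        · exact Or.inl ⟨h, hq.2⟩
        · exact Or.inr ⟨hq.1, h⟩
      exact (measure_mono hsub).trans ((measure_union_le _ _).trans
        ((add_le_add hn.le (hdiff (φ n) l k)).trans (zero_add _).le))
    have h := (hac i hi).prod (hbc j hj) hpart
    rwa [Measure.prod_restrict, Measure.restrict_apply (hZ l)] at h

/-! ### Empirical measures and the choice of a good sample -/

instance isProbabilityMeasure_uniformOn_univ_fin (n : ℕ) :
    IsProbabilityMeasure (uniformOn (Set.univ : Set (Fin (n + 1)))) :=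
  isProbabilityMeasure_uniformOn Set.finite_univ Set.univ_nonempty

/-- The empirical distribution of the points `z 0, …, z n`. -/
noncomputable def empiricalMeasure {Z : Type*} [MeasurableSpace Z] {n : ℕ} (z : Fin (n + 1) → Z) :
    ProbabilityMeasure Z :=
  ⟨(uniformOn Set.univ).map z, Measure.isProbabilityMeasure_map (measurable_of_finite z).aemeasurable⟩

section Empirical

variable {Z W : Type*} [MeasurableSpace Z] [MeasurableSpace W] {n : ℕ}

theorem toMeasure_empiricalMeasure (z : Fin (n + 1) → Z) :
    (empiricalMeasure z : Measure Z) = (uniformOn Set.univ).map z := rfl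

open Classical in
theorem empiricalMeasure_apply (z : Fin (n + 1) → Z) {A : Set Z} (hA : MeasurableSet A) :
    (empiricalMeasure z : Measure Z) A =
      ENNReal.ofReal (((Finset.univ.filter fun s => z s ∈ A).card : ℝ) / (n + 1 : ℕ)) := by
  rw [toMeasure_empiricalMeasure, Measure.map_apply (measurable_of_finite z) hA, uniformOn_univ,
    ENNReal.ofReal_div_of_pos (by positivity), Fintype.card_fin, ENNReal.ofReal_natCast,
    ENNReal.ofReal_natCast]
  congr 1
  rw [← Measure.count_apply_finset]
  congr 1
  ext
  simp

theorem map_empiricalMeasure (z : Fin (n + 1) → Z) {g : Z → W} (hg : Measurable g) :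
    (empiricalMeasure z).map hg.aemeasurable = empiricalMeasure (g ∘ z) :=
  Subtype.ext (Measure.map_map hg (measurable_of_finite z))

theorem empiricalMeasure_prod_apply (z : Fin (n + 1) → Z) (w : Fin (n + 1) → W) {A : Set (Z × W)}
    (hA : MeasurableSet A) :
    ((empiricalMeasure z : Measure Z).prod (empiricalMeasure w : Measure W)) A =
      ((uniformOn Set.univ).prod (uniformOn Set.univ)) {q | (z q.1, w q.2) ∈ A} := by
  rw [toMeasure_empiricalMeasure, toMeasure_empiricalMeasure,
    Measure.map_prod_map _ _ (measurable_of_finite z) (measurable_of_finite w),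
    Measure.map_apply (measurable_of_finite _) hA]
  rfl

end Empirical

section Sampling

variable {X Y Ω : Type*} [MeasurableSpace X] [MeasurableSpace Y] [MeasurableSpace Ω]
  {μ : Measure X} {ν : Measure Y} {P : Measure Ω} [IsProbabilityMeasure P]
  {x : ℕ → Ω → X} {y : ℕ → Ω → Y}

theorem ae_tendsto_empiricalMeasure {μ : ProbabilityMeasure X} [TopologicalSpace X]
    [SecondCountableTopology X] [OpensMeasurableSpace X]
    (hx : ∀ i, HasLaw (x i) μ P) (hx_indep : iIndepFun x P) :
    ∀ᵐ ω ∂P, Tendsto (fun n : ℕ => empiricalMeasure fun s : Fin (n + 1) => x s ω) atTop (𝓝 μ) := by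
  classical
  let B := TopologicalSpace.countableBasis X
  -- Finite intersections of basic open sets form a countable π-system containing a neighbourhood
  -- basis, so frequencies on it suffice for weak convergence.
  let S : Set (Set X) := Set.sInter '' {F | F.Finite ∧ F ⊆ B}
  have hSc : S.Countable :=
    (Set.countable_ofPred_finite_subset (TopologicalSpace.countable_countableBasis X)).image _
  have hSo : ∀ A ∈ S, IsOpen A := by
    rintro _ ⟨F, ⟨hF, hFB⟩, rfl⟩
    exact hF.isOpen_sInter fun A hA => TopologicalSpace.isOpen_of_mem_countableBasis (hFB hA)
  have hfreq : ∀ᵐ ω ∂P, ∀ A ∈ S, Tendsto (fun n : ℕ =>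
      (((Finset.range n).filter fun s => x s ω ∈ A).card : ℝ) / n)
      atTop (𝓝 ((μ : Measure X).real A)) :=
    (ae_ball_iff hSc).2 fun A hA => ae_tendsto_frequency hx hx_indep (hSo A hA).measurableSet
  filter_upwards [hfreq] with ω hω
  refine IsPiSystem.tendsto_probabilityMeasure_of_tendsto_of_mem (S := S) ?_
    (fun A hA => (hSo A hA).measurableSet) ?_ fun A hA => ?_
  · rintro _ ⟨F, ⟨hF, hFB⟩, rfl⟩ _ ⟨G, ⟨hG, hGB⟩, rfl⟩ -
    exact ⟨F ∪ G, ⟨hF.union hG, Set.union_subset hFB hGB⟩, Set.sInter_union _ _⟩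
  · intro U hU z hz
    obtain ⟨A, hA, hzA, hAU⟩ :=
      (TopologicalSpace.isBasis_countableBasis X).exists_subset_of_mem_open hz hU
    exact ⟨A, ⟨{A}, ⟨Set.finite_singleton _, by simpa using hA⟩, Set.sInter_singleton _⟩,
      (TopologicalSpace.isOpen_of_mem_countableBasis hA).mem_nhds hzA, hAU⟩
  · have h := ENNReal.tendsto_ofReal ((tendsto_add_atTop_iff_nat 1).2 (hω A hA))
    rw [ofReal_measureReal] at h
    rw [← ENNReal.tendsto_coe]
    simp only [ProbabilityMeasure.ennreal_coeFn_eq_coeFn_toMeasure]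
    refine h.congr fun n => ?_
    rw [empiricalMeasure_apply _ (hSo A hA).measurableSet,
      card_filter_fin_eq_card_filter_range (n + 1) fun s => x s ω ∈ A]

/-- Every pair `(x s, y t)`, including `s = t`, has law `μ.prod ν`; averaging over the grid
therefore preserves the expectation. -/
theorem lintegral_sample_pairs (hx : ∀ i, HasLaw (x i) μ P) (hy : ∀ j, HasLaw (y j) ν P)
    (hxy_indep : IndepFun (fun ω i => x i ω) (fun ω j => y j ω) P) (n : ℕ) {A : Set (X × Y)}
    (hA : MeasurableSet A) :
    AEMeasurable (fun ω => ((uniformOn Set.univ).prod (uniformOn Set.univ))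
      {q : Fin (n + 1) × Fin (n + 1) | (x q.1 ω, y q.2 ω) ∈ A}) P ∧
    ∫⁻ ω, ((uniformOn Set.univ).prod (uniformOn Set.univ))
      {q : Fin (n + 1) × Fin (n + 1) | (x q.1 ω, y q.2 ω) ∈ A} ∂P = (μ.prod ν) A := by
  set u := (uniformOn (Set.univ : Set (Fin (n + 1)))).prod (uniformOn (Set.univ : Set (Fin (n + 1))))
  have hsum : ∀ ω, u {q | (x q.1 ω, y q.2 ω) ∈ A} =
      ∑ q, A.indicator 1 (x q.1 ω, y q.2 ω) * u {q} := by
    intro ω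
    rw [← lintegral_fintype (fun q : Fin (n + 1) × Fin (n + 1) =>
      A.indicator (1 : X × Y → ENNReal) (x q.1 ω, y q.2 ω)),
      ← lintegral_indicator_one (Set.toFinite _).measurableSet]
    rfl
  have hm : ∀ s t : ℕ, AEMeasurable (fun ω => A.indicator (1 : X × Y → ENNReal) (x s ω, y t ω)) P :=
    fun s t => (measurable_one.indicator hA).comp_aemeasurable
      (hasLaw_sample_pair hx hy hxy_indep s t).aemeasurable
  simp_rw [hsum]
  refine ⟨Finset.aemeasurable_fun_sum _ fun q _ => (hm _ _).mul_const _, ?_⟩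
  rw [lintegral_finsetSum' _ fun q _ => (hm _ _).mul_const _]
  have hint : ∀ s t : ℕ, ∫⁻ ω, A.indicator (1 : X × Y → ENNReal) (x s ω, y t ω) ∂P = μ.prod ν A :=
    fun s t => by
      rw [(hasLaw_sample_pair hx hy hxy_indep s t).lintegral_comp
        (measurable_one.indicator hA).aemeasurable, lintegral_indicator_one hA]
  simp_rw [lintegral_mul_const'' _ (hm _ _), hint]
  rw [← Finset.mul_sum, sum_measure_singleton]
  simp [u]

end Sampling

theorem measurableSet_finiteBlockStructure (ε : ℝ) (N n : ℕ) :
    MeasurableSet {m : Fin n → Fin n → ℝ | FiniteBlockStructure ε N n m} := by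
  have hm : ∀ s t r p : Fin n, Measurable fun m : Fin n → Fin n → ℝ => |m s t - m r p| < ε :=
    fun s t r p => measurableSet_setOfPred.1 (measurableSet_lt (by fun_prop) measurable_const)
  refine measurableSet_setOfPred.2 ?_
  unfold FiniteBlockStructure VariesLessOnBlocks
  refine Measurable.exists fun a => Measurable.exists fun b => measurable_const.and
    (measurable_const.and ?_)
  refine Measurable.forall fun i => Measurable.forall fun j => measurable_const.imp
    (measurable_const.imp ?_)
  refine Measurable.forall fun s => Measurable.forall fun r => Measurable.forall fun t =>
    Measurable.forall fun p => ?_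
  exact measurable_const.imp (measurable_const.imp (measurable_const.imp
    (measurable_const.imp (hm s t r p))))

/-- Otherwise the complements of `E n \ B n` would have probability tending to `1`, yet they are
bounded by a quantity tending to `1 / 4`. -/
theorem frequently_mem_of_tendsto_measure {Ω : Type*} [MeasurableSpace Ω] {P : Measure Ω}
    [IsProbabilityMeasure P] {E B : ℕ → Set Ω} (hE : ∀ n, NullMeasurableSet (E n) P)
    (hlim : Tendsto (fun n => P (E n)) atTop (𝓝 1)) (hB : ∀ n, P (B n) ≤ 1 / 4) :
    ∃ᶠ ω in ae P, ∃ᶠ n in atTop, ω ∈ E n \ B n := by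
  intro h
  have h₁ : Tendsto (fun n => P (E n \ B n)ᶜ) atTop (𝓝 1) :=
    tendsto_measure_of_ae_eventually (by simpa [not_frequently] using h)
  have h₂ : Tendsto (fun n => P (E n)ᶜ) atTop (𝓝 0) := by
    have := ENNReal.Tendsto.sub (tendsto_const_nhds (x := (1 : ENNReal))) hlim
      (Or.inl ENNReal.one_ne_top)
    rw [tsub_self] at this
    exact this.congr fun n => (prob_compl_eq_one_sub₀ (hE n)).symm
  have h₃ : Tendsto (fun n => P (E n)ᶜ + 1 / 4) atTop (𝓝 (0 + 1 / 4)) := h₂.add_const _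
  have h₄ : (1 : ENNReal) ≤ 0 + 1 / 4 := le_of_tendsto_of_tendsto' h₁ h₃ fun n => by
    rw [Set.compl_sdiff]
    refine (measure_union_le _ _).trans ?_
    rw [add_comm]
    gcongr
    exact hB n
  rw [zero_add, ENNReal.le_div_iff_mul_le (by simp) (by simp)] at h₄
  norm_num at h₄

/-- One entry within `ε` of `c` forces the whole block within `2 * ε`. This expresses small
oscillation through blocks missing sets, the form that survives the weak limit. -/
theorem VariesLessOnBlocks.block_dichotomy {ι : Type*} {N : ℕ} {m : ι → ι → ℝ}
    {a b : ι → Fin (N + 1)} {ε : ℝ} (h : VariesLessOnBlocks m a b ε) {i j : Fin (N + 1)}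
    (hi : i ≠ 0) (hj : j ≠ 0) (c : ℝ) :
    (∀ s t, a s = i → b t = j → ¬ |m s t - c| < ε) ∨
      ∀ s t, a s = i → b t = j → ¬ 2 * ε ≤ |m s t - c| := by
  refine or_iff_not_imp_left.2 fun hc s t hs ht => ?_
  push Not at hc
  obtain ⟨r, p, hr, hp, hrp⟩ := hc
  have := h i j (Fin.pos_of_ne_zero hi) (Fin.pos_of_ne_zero hj) s r t p hs hr ht hp
  have := abs_sub_le (m s t) (m r p) c
  linarith

section Sampling

variable {X Y Ω : Type*} [MeasurableSpace X] [MeasurableSpace Y] [MeasurableSpace Ω]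
  {μ : Measure X} {ν : Measure Y} {P : Measure Ω}
  {x : ℕ → Ω → X} {y : ℕ → Ω → Y}

theorem nullMeasurableSet_finiteBlockStructure
    (hx : ∀ i, HasLaw (x i) μ P) (hy : ∀ j, HasLaw (y j) ν P) {f : X × Y → ℝ} (hf : Measurable f)
    (ε : ℝ) (N n : ℕ) :
    NullMeasurableSet {ω | FiniteBlockStructure ε N n (fun s t : Fin n => f (x s ω, y t ω))} P := by
  have hM : AEMeasurable (fun ω => (fun s t => f (x s ω, y t ω) : Fin n → Fin n → ℝ)) P :=
    aemeasurable_pi_lambda _ fun s => aemeasurable_pi_lambda _ fun t =>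
      hf.comp_aemeasurable ((hx s).aemeasurable.prodMk (hy t).aemeasurable)
  exact hM.nullMeasurable (measurableSet_finiteBlockStructure ε N n)

/-- Countably many measurable sets are approximated by open sets so well that empirical product
measures are close on all of them simultaneously, with probability at least `3 / 4`. -/
theorem exists_open_approx_sample [IsProbabilityMeasure P] [IsFiniteMeasure μ] [IsFiniteMeasure ν]
    [TopologicalSpace (X × Y)] [(μ.prod ν).OuterRegular] [OpensMeasurableSpace (X × Y)]
    {ι : Type*} [Countable ι]
    (hx : ∀ i, HasLaw (x i) μ P) (hy : ∀ j, HasLaw (y j) ν P)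
    (hxy_indep : IndepFun (fun ω i => x i ω) (fun ω j => y j ω) P)
    {Z : ι → Set (X × Y)} (hZ : ∀ l, MeasurableSet (Z l)) {δ : ℕ → ENNReal} (hδ : ∀ k, δ k ≠ 0)
    (hδ' : ∀ k, δ k ≠ ⊤) :
    ∃ O : ι → ℕ → Set (X × Y), (∀ l k, IsOpen (O l k)) ∧ (∀ l k, Z l ⊆ O l k) ∧
      ∀ n : ℕ, P {ω | ∃ l k, δ k ≤ ((uniformOn Set.univ).prod (uniformOn Set.univ))
        {q : Fin (n + 1) × Fin (n + 1) | (x q.1 ω, y q.2 ω) ∈ O l k \ Z l}} ≤ 1 / 4 := by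
  obtain ⟨η, hη, hηsum⟩ := ENNReal.exists_pos_sum_of_countable (ε := 1 / 4) (by simp) (ι × ℕ)
  -- The factor `δ k` cancels in Markov's inequality, and the summable `η` absorbs the union bound
  -- over all `(l, k)`.
  have hO : ∀ l k, ∃ O ⊇ Z l, IsOpen O ∧ (μ.prod ν) O < ⊤ ∧ (μ.prod ν) (O \ Z l) < η (l, k) * δ k :=
    fun l k => (hZ l).exists_isOpen_sdiff_lt (measure_ne_top _ _)
      (mul_ne_zero (by exact_mod_cast (hη (l, k)).ne') (hδ k))
  choose O hZO hO _ hlt using hO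
  refine ⟨O, hO, hZO, fun n => ?_⟩
  have hunion : {ω | ∃ l k, δ k ≤ ((uniformOn Set.univ).prod (uniformOn Set.univ))
        {q : Fin (n + 1) × Fin (n + 1) | (x q.1 ω, y q.2 ω) ∈ O l k \ Z l}} =
      ⋃ p : ι × ℕ, {ω | δ p.2 ≤ ((uniformOn Set.univ).prod (uniformOn Set.univ))
        {q : Fin (n + 1) × Fin (n + 1) | (x q.1 ω, y q.2 ω) ∈ O p.1 p.2 \ Z p.1}} := by
    ext
    simp
  rw [hunion]
  refine (measure_iUnion_le _).trans ((ENNReal.tsum_le_tsum fun p => ?_).trans hηsum.le)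
  obtain ⟨hm, hint⟩ := lintegral_sample_pairs hx hy hxy_indep n
    ((hO p.1 p.2).measurableSet.diff (hZ p.1))
  refine (meas_ge_le_lintegral_div hm (hδ p.2) (hδ' p.2)).trans ?_
  rw [hint]
  exact ENNReal.div_le_of_le_mul (hlt p.1 p.2).le

end Sampling

theorem empiricalMeasure_label_zero_le {X : Type*} [MeasurableSpace X] {n N : ℕ} {ε : ℝ}
    (z : Fin (n + 1) → X) {a : Fin (n + 1) → Fin (N + 1)}
    (h : ((Finset.univ.filter fun s => a s = 0).card : ℝ) < ε * (n + 1 : ℕ)) :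
    (empiricalMeasure fun s => (z s, a s) : Measure (X × Fin (N + 1))) (Set.univ ×ˢ {0}) ≤
      ENNReal.ofReal ε := by
  classical
  rw [empiricalMeasure_apply _ (MeasurableSet.univ.prod (measurableSet_singleton 0))]
  refine ENNReal.ofReal_le_ofReal ((div_le_iff₀ (by positivity)).2 ?_)
  refine le_trans (le_of_eq ?_) h.le
  congr! 2
  ext
  simp

theorem exists_labels_of_tendsto_of_compact {X Y Ω : Type*}
    [TopologicalSpace X] [PolishSpace X] [CompactSpace X] [MeasurableSpace X] [BorelSpace X]
    [TopologicalSpace Y] [PolishSpace Y] [CompactSpace Y] [MeasurableSpace Y] [BorelSpace Y]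
    [MeasurableSpace Ω] {μ : Measure X} [IsProbabilityMeasure μ] {ν : Measure Y}
    [IsProbabilityMeasure ν] {P : Measure Ω} [IsProbabilityMeasure P]
    {x : ℕ → Ω → X} {y : ℕ → Ω → Y} (hx : ∀ i, HasLaw (x i) μ P) (hy : ∀ j, HasLaw (y j) ν P)
    (hx_indep : iIndepFun x P) (hy_indep : iIndepFun y P)
    (hxy_indep : IndepFun (fun ω i => x i ω) (fun ω j => y j ω) P)
    {f : X × Y → ℝ} (hf : Measurable f) {ε : ℝ} (hε : 0 < ε) {N : ℕ}
    (h : Tendsto (fun n : ℕ => P {ω | FiniteBlockStructure ε N n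
      (fun s t : Fin n => f (x s ω, y t ω))}) atTop (𝓝 1)) :
    ∃ (a : X → Fin (N + 1)) (b : Y → Fin (N + 1)), Measurable a ∧ Measurable b ∧
      μ (a ⁻¹' {0}) ≤ ENNReal.ofReal ε ∧ ν (b ⁻¹' {0}) ≤ ENNReal.ofReal ε ∧
      ∀ i ≠ 0, ∀ j ≠ 0, ∃ c : ℝ, ∀ᵐ p ∂μ.prod ν, a p.1 = i → b p.2 = j → |f p - c| < 2 * ε := by
  -- Both alternatives of the block dichotomy, for rational centres only, to keep the family
  -- countable.
  let Z : ℚ × Bool → Set (X × Y) := fun l =>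
    if l.2 then {p | |f p - l.1| < ε} else {p | 2 * ε ≤ |f p - l.1|}
  have hZ : ∀ l, MeasurableSet (Z l) := by
    rintro ⟨c, _ | _⟩
    · exact measurableSet_le measurable_const (hf.sub_const _).abs
    · exact measurableSet_lt (hf.sub_const _).abs measurable_const
  let δ : ℕ → ENNReal := fun k => ((k + 1 : ℕ) : ENNReal)⁻¹
  have hδ : Tendsto δ atTop (𝓝 0) :=
    (tendsto_add_atTop_iff_nat 1).2 ENNReal.tendsto_inv_nat_nhds_zero
  obtain ⟨O, hO, hZO, hB⟩ := exists_open_approx_sample hx hy hxy_indep hZ (δ := δ)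
    (fun k => ENNReal.inv_ne_zero.2 (ENNReal.natCast_ne_top _))
    (fun k => ENNReal.inv_ne_top.2 (by simp))
  have hfreq := frequently_mem_of_tendsto_measure
    (fun n => nullMeasurableSet_finiteBlockStructure hx hy hf ε N (n + 1))
    ((tendsto_add_atTop_iff_nat 1).2 h) hB
  obtain ⟨ω, hω, hωx, hωy⟩ := (hfreq.and_eventually
    ((ae_tendsto_empiricalMeasure (μ := ⟨μ, inferInstance⟩) hx hx_indep).and
    (ae_tendsto_empiricalMeasure (μ := ⟨ν, inferInstance⟩) hy hy_indep))).exists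
  obtain ⟨ψ, hψ, hψω⟩ := extraction_of_frequently_atTop hω
  choose a₀ b₀ ha₀ hb₀ hab₀ using fun n => (hψω n).1
  have hdiff : ∀ n l k, ((uniformOn Set.univ).prod (uniformOn Set.univ))
      {q : Fin (ψ n + 1) × Fin (ψ n + 1) | (x q.1 ω, y q.2 ω) ∈ O l k \ Z l} ≤ δ k :=
    fun n l k => le_of_not_ge fun hle => (hψω n).2 ⟨l, k, hle⟩
  have hpre : Measurable fun q : (X × Fin (N + 1)) × (Y × Fin (N + 1)) => (q.1.1, q.2.1) := by
    fun_prop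
  obtain ⟨a, b, ha, hb, ha0, hb0, φ, -, hφ⟩ := exists_labels_of_weak_limit
    (μ := ⟨μ, inferInstance⟩) (ν := ⟨ν, inferInstance⟩)
    (π := fun n => empiricalMeasure fun s : Fin (ψ n + 1) => (x s ω, a₀ n s))
    (σ := fun n => empiricalMeasure fun s : Fin (ψ n + 1) => (y s ω, b₀ n s))
    (by simpa only [map_empiricalMeasure _ measurable_fst] using! hωx.comp hψ.tendsto_atTop)
    (by simpa only [map_empiricalMeasure _ measurable_fst] using! hωy.comp hψ.tendsto_atTop)
    (fun n => empiricalMeasure_label_zero_le _ (ha₀ n))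
    (fun n => empiricalMeasure_label_zero_le _ (hb₀ n)) hZ hO hZO hδ (fun n l k => by
      refine (empiricalMeasure_prod_apply _ _
        (hpre ((hO l k).measurableSet.diff (hZ l)))).trans_le ?_
      exact hdiff n l k)
  refine ⟨a, b, ha, hb, ha0, hb0, fun i hi j hj => ?_⟩
  have hzero : ∀ l, (∃ᶠ n in atTop, ∀ s t, a₀ (φ n) s = i → b₀ (φ n) t = j →
      (x s ω, y t ω) ∉ Z l) → ∀ᵐ p ∂μ.prod ν, a p.1 = i → b p.2 = j → p ∉ Z l := by
    intro l hl
    have h0 := hφ i hi j hj l (hl.mono fun n hn => by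
      have hmeas : MeasurableSet {q : (X × Fin (N + 1)) × (Y × Fin (N + 1)) |
          (q.1.1, q.2.1) ∈ Z l ∧ q.1.2 = i ∧ q.2.2 = j} :=
        (hpre (hZ l)).inter ((measurableSet_eq_fun (by fun_prop) measurable_const).inter
          (measurableSet_eq_fun (by fun_prop) measurable_const))
      refine (empiricalMeasure_prod_apply _ _ hmeas).trans ?_
      exact (congrArg _ (Set.eq_empty_of_forall_notMem fun q hq =>
        hn q.1 q.2 hq.2.1 hq.2.2 hq.1)).trans measure_empty)
    refine ae_iff.2 (measure_mono_null ?_ h0)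
    intro p hp
    simp only [Set.mem_ofPred_eq, Classical.not_imp, not_not] at hp
    exact ⟨hp.2.2, hp.1, hp.2.1⟩
  -- Either some rational centre works infinitely often and persists in the limit, or on the limit
  -- block `f` almost everywhere stays at least `ε` from every rational. The latter forces the block
  -- to be null, so any constant will do.
  by_cases hc : ∃ c : ℚ, ∃ᶠ n in atTop, ∀ s t, a₀ (φ n) s = i → b₀ (φ n) t = j →
      (x s ω, y t ω) ∉ Z (c, false)
  · obtain ⟨c, hc⟩ := hc
    refine ⟨c, (hzero _ hc).mono fun p hp hpi hpj => ?_⟩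
    exact not_le.1 (hp hpi hpj)
  · push Not at hc
    have hall : ∀ᵐ p ∂μ.prod ν, ∀ c : ℚ, a p.1 = i → b p.2 = j → p ∉ Z (c, true) := by
      refine ae_all_iff.2 fun c => hzero _ ?_
      refine Eventually.frequently ?_
      refine (hc c).mono fun n hn => ((hab₀ (φ n)).block_dichotomy hi hj c).resolve_right ?_
      obtain ⟨s, t, hs, ht, hst⟩ := hn
      exact fun H => H s t hs ht hst
    refine ⟨0, hall.mono fun p hp hpi hpj => ?_⟩
    obtain ⟨c, hc₁, hc₂⟩ := exists_rat_btwn (show f p - ε < f p + ε by linarith)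
    refine absurd ?_ (hp c hpi hpj)
    change |f p - c| < ε
    rw [abs_lt]
    constructor <;> linarith

theorem exists_compact_polish_borel {X : Type*} [MeasurableSpace X] [StandardBorelSpace X]
    (μ : Measure X) [IsProbabilityMeasure μ] [NullSingletonClass μ] :
    ∃ _ : TopologicalSpace X, PolishSpace X ∧ CompactSpace X ∧ BorelSpace X := by
  have hX : ¬ Countable X := fun _ => by
    have h : μ Set.univ = 0 := (Set.countable_univ (α := X)).measure_zero μ
    simp at h
  have hI : ¬ Countable unitInterval := fun h => by
    have := Cardinal.mk_le_aleph0_iff.2 h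
    rw [unitInterval, Cardinal.mk_Icc_real zero_lt_one] at this
    exact this.not_gt Cardinal.aleph0_lt_continuum
  -- Absence of atoms makes the space uncountable, hence Borel isomorphic to the interval, whose
  -- compact topology is pulled back to obtain weakly compact spaces of probability measures.
  let e : X ≃ᵐ unitInterval := PolishSpace.measurableEquivOfNotCountable hX hI
  let τ : TopologicalSpace X := TopologicalSpace.induced e inferInstance
  let h : X ≃ₜ unitInterval := e.toEquiv.toHomeomorphOfIsInducing ⟨rfl⟩
  refine ⟨τ, h.isClosedEmbedding.polishSpace, h.symm.compactSpace, ⟨?_⟩⟩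
  rw [← e.measurableEmbedding.comap_eq]
  exact (congrArg (MeasurableSpace.comap e) BorelSpace.measurable_eq).trans borel_comap.symm

theorem exists_labels_of_tendsto {X Y Ω : Type*}
    [MeasurableSpace X] [StandardBorelSpace X] [MeasurableSpace Y] [StandardBorelSpace Y]
    [MeasurableSpace Ω] {μ : Measure X} [IsProbabilityMeasure μ] [NullSingletonClass μ]
    {ν : Measure Y} [IsProbabilityMeasure ν] [NullSingletonClass ν]
    {P : Measure Ω} [IsProbabilityMeasure P]
    {x : ℕ → Ω → X} {y : ℕ → Ω → Y} (hx : ∀ i, HasLaw (x i) μ P) (hy : ∀ j, HasLaw (y j) ν P)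
    (hx_indep : iIndepFun x P) (hy_indep : iIndepFun y P)
    (hxy_indep : IndepFun (fun ω i => x i ω) (fun ω j => y j ω) P)
    {f : X × Y → ℝ} (hf : AEMeasurable f (μ.prod ν)) {ε : ℝ} (hε : 0 < ε) {N : ℕ}
    (h : Tendsto (fun n : ℕ => P {ω | FiniteBlockStructure ε N n
      (fun s t : Fin n => f (x s ω, y t ω))}) atTop (𝓝 1)) :
    ∃ (a : X → Fin (N + 1)) (b : Y → Fin (N + 1)), Measurable a ∧ Measurable b ∧
      μ (a ⁻¹' {0}) ≤ ENNReal.ofReal ε ∧ ν (b ⁻¹' {0}) ≤ ENNReal.ofReal ε ∧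
      ∀ i ≠ 0, ∀ j ≠ 0, ∃ c : ℝ, ∀ᵐ p ∂μ.prod ν, a p.1 = i → b p.2 = j → |f p - c| < 2 * ε := by
  obtain ⟨_, _, _, _⟩ := exists_compact_polish_borel μ
  obtain ⟨_, _, _, _⟩ := exists_compact_polish_borel ν
  have hmk : Tendsto (fun n : ℕ => P {ω | FiniteBlockStructure ε N n
      (fun s t : Fin n => hf.mk f (x s ω, y t ω))}) atTop (𝓝 1) := by
    refine h.congr fun n => measure_congr ?_
    filter_upwards [ae_forall_sample_pair hx hy hxy_indep hf.ae_eq_mk] with ω hω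
    change FiniteBlockStructure _ _ _ _ = FiniteBlockStructure _ _ _ _
    simp only [hω]
  obtain ⟨a, b, ha, hb, ha0, hb0, hab⟩ := exists_labels_of_tendsto_of_compact hx hy hx_indep
    hy_indep hxy_indep hf.measurable_mk hε hmk
  refine ⟨a, b, ha, hb, ha0, hb0, fun i hi j hj => ?_⟩
  obtain ⟨c, hc⟩ := hab i hi j hj
  refine ⟨c, ?_⟩
  filter_upwards [hc, hf.ae_eq_mk] with p hp hfp
  rwa [hfp]

/-! ### From step approximations to a continuous version -/

/-- The semimetric pulled back along a map to a pseudometrizable space. -/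
noncomputable abbrev pullbackSemimetric {X V : Type*} [TopologicalSpace V]
    [TopologicalSpace.PseudoMetrizableSpace V] (Φ : X → V) : PseudoMetricSpace X :=
  PseudoMetricSpace.induced Φ (TopologicalSpace.pseudoMetrizableSpacePseudoMetric V)

theorem continuous_pullbackSemimetric {X V : Type*} [TopologicalSpace V]
    [TopologicalSpace.PseudoMetrizableSpace V] (Φ : X → V) :
    Continuous[(pullbackSemimetric Φ).toUniformSpace.toTopologicalSpace, _] Φ :=
  continuous_induced_dom

theorem isAdmissible_pullbackSemimetric {X V : Type*} [MeasurableSpace X] (μ : Measure X)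
    [TopologicalSpace V] [TopologicalSpace.PseudoMetrizableSpace V] [SecondCountableTopology V]
    [MeasurableSpace V] [OpensMeasurableSpace V] {Φ : X → V} (hΦ : Measurable Φ) :
    IsAdmissible μ (pullbackSemimetric Φ) := by
  let : PseudoMetricSpace V := TopologicalSpace.pseudoMetrizableSpacePseudoMetric V
  refine ⟨?_, Set.univ, by simp, ?_⟩
  · exact ((hΦ.comp measurable_fst).dist (hΦ.comp measurable_snd)).aemeasurable
  · have := TopologicalSpace.secondCountableTopology_induced X V Φ
    exact @TopologicalSpace.isSeparable_univ_iff X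
      (pullbackSemimetric Φ).toUniformSpace.toTopologicalSpace |>.2 inferInstance

/-- Keep the points whose label sequence lies in the support of its law on `ℕ → ℕ`. Fixing two
coordinates is an open condition, so the corresponding cell has positive measure; only the tail of
`η` is lost. -/
theorem exists_measurableSet_forall_cell_ne_zero {X : Type*} [MeasurableSpace X] {μ : Measure X}
    [IsFiniteMeasure μ] {a : ℕ → X → ℕ} (ha : ∀ n, Measurable (a n)) {η : ℕ → ENNReal}
    (hη : ∀ n, μ (a n ⁻¹' {0}) ≤ η n) (m : ℕ) :
    ∃ S : Set X, MeasurableSet S ∧ μ Sᶜ ≤ ∑' k, η (k + m) ∧ ∀ x ∈ S, ∀ n ≥ m, ∀ k ≥ m,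
      μ {z | a n z ≠ 0 ∧ a k z ≠ 0 ∧ a n z = a n x ∧ a k z = a k x} ≠ 0 := by
  let T : Set X := ⋂ k, (a (k + m) ⁻¹' {0})ᶜ
  have hT : MeasurableSet T := MeasurableSet.iInter fun k => (ha _ (measurableSet_singleton 0)).compl
  have hTmem : ∀ z ∈ T, ∀ n ≥ m, a n z ≠ 0 := fun z hz n hn => by
    have := Set.mem_iInter.1 hz (n - m)
    rwa [Nat.sub_add_cancel hn] at this
  let Φ : X → ℕ → ℕ := fun x n => a n x
  have hΦ : Measurable Φ := measurable_pi_iff.2 ha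
  let κ : Measure (ℕ → ℕ) := (μ.restrict T).map Φ
  have hsupp : MeasurableSet (Φ ⁻¹' κ.support) := hΦ Measure.isClosed_support.measurableSet
  refine ⟨T ∩ Φ ⁻¹' κ.support, hT.inter hsupp, ?_, fun x hx n hn k hk h0 => ?_⟩
  · have h1 : μ (T \ Φ ⁻¹' κ.support) = 0 := by
      have : κ κ.supportᶜ = 0 := Measure.support_mem_ae
      rw [Measure.map_apply hΦ Measure.isClosed_support.measurableSet.compl,
        Measure.restrict_apply (hΦ Measure.isClosed_support.measurableSet.compl)] at this
      rwa [Set.sdiff_eq, Set.inter_comm]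
    have h2 : (T ∩ Φ ⁻¹' κ.support)ᶜ ⊆ (⋃ k, a (k + m) ⁻¹' {0}) ∪ (T \ Φ ⁻¹' κ.support) := by
      intro z hz
      by_cases hzT : z ∈ T
      · exact Or.inr ⟨hzT, fun h => hz ⟨hzT, h⟩⟩
      · left
        simpa [T] using hzT
    refine (measure_mono h2).trans ((measure_union_le _ _).trans ?_)
    rw [h1, add_zero]
    exact (measure_iUnion_le _).trans (ENNReal.tsum_le_tsum fun k => hη _)
  · have hU : IsOpen {v : ℕ → ℕ | v n = a n x ∧ v k = a k x} := by
      have h : ∀ n, IsOpen {v : ℕ → ℕ | v n = a n x} := fun n =>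
        (isOpen_discrete {a n x}).preimage (f := fun v : ℕ → ℕ => v n) (continuous_apply n)
      exact (h n).inter (h k)
    have hpos := (Measure.mem_support_iff_forall _).1 hx.2 _ (hU.mem_nhds ⟨rfl, rfl⟩)
    rw [Measure.map_apply hΦ hU.measurableSet, Measure.restrict_apply (hΦ hU.measurableSet)] at hpos
    refine hpos.ne' (measure_mono_null ?_ h0)
    rintro z ⟨hz, hzT⟩
    exact ⟨hTmem z hzT n hn, hTmem z hzT k hk, hz.1, hz.2⟩

theorem virtuallyContinuous_of_step_approx {X Y : Type*} [MeasurableSpace X] [MeasurableSpace Y]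
    {μ : Measure X} [IsProbabilityMeasure μ] {ν : Measure Y} [IsProbabilityMeasure ν]
    {f : X × Y → ℝ} (hf : AEMeasurable f (μ.prod ν)) {a : ℕ → X → ℕ} {b : ℕ → Y → ℕ}
    (ha : ∀ n, Measurable (a n)) (hb : ∀ n, Measurable (b n)) (c : ℕ → ℕ → ℕ → ℝ)
    {η : ℕ → ENNReal} (hη : ∑' n, η n ≠ ⊤) (ha0 : ∀ n, μ (a n ⁻¹' {0}) ≤ η n)
    (hb0 : ∀ n, ν (b n ⁻¹' {0}) ≤ η n) {δ : ℕ → ℝ} (hδ : Tendsto δ atTop (𝓝 0))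
    (hfc : ∀ n, ∀ᵐ p ∂μ.prod ν, a n p.1 ≠ 0 → b n p.2 ≠ 0 →
      |f p - c n (a n p.1) (b n p.2)| < δ n) :
    VirtuallyContinuous μ ν f := by
  let h : ℕ → X × Y → ℝ := fun n p => c n (a n p.1) (b n p.2)
  let g : X × Y → ℝ := fun p => limUnder atTop fun n => h n p
  have hfc' : ∀ᵐ p ∂μ.prod ν, ∀ n, a n p.1 ≠ 0 → b n p.2 ≠ 0 → |f p - h n p| < δ n :=
    ae_all_iff.2 hfc
  have hfg : f =ᵐ[μ.prod ν] g := by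
    have hx : ∀ᵐ z ∂μ, ∀ᶠ n in atTop, z ∉ a n ⁻¹' {0} := ae_eventually_notMem
      (ne_top_of_le_ne_top hη (ENNReal.tsum_le_tsum ha0))
    have hy : ∀ᵐ z ∂ν, ∀ᶠ n in atTop, z ∉ b n ⁻¹' {0} := ae_eventually_notMem
      (ne_top_of_le_ne_top hη (ENNReal.tsum_le_tsum hb0))
    filter_upwards [hfc', Measure.quasiMeasurePreserving_fst.ae hx,
      Measure.quasiMeasurePreserving_snd.ae hy] with p hp hpx hpy
    refine (Tendsto.limUnder_eq ?_).symm
    refine tendsto_iff_dist_tendsto_zero.2 (squeeze_zero' (Eventually.of_forall fun _ => dist_nonneg)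
      ?_ hδ)
    filter_upwards [hpx, hpy] with n hnx hny
    rw [dist_comm, Real.dist_eq]
    exact (hp n hnx hny).le
  refine ⟨g, ⟨hf.congr hfg, fun ε hε => ?_⟩, hfg⟩
  obtain ⟨m, hm⟩ := ((ENNReal.tendsto_sum_nat_add η hη).eventually_le_const
    (ENNReal.ofReal_pos.2 hε)).exists
  obtain ⟨S, hS, hSμ, hScell⟩ := exists_measurableSet_forall_cell_ne_zero ha ha0 m
  obtain ⟨T, hT, hTν, hTcell⟩ := exists_measurableSet_forall_cell_ne_zero hb hb0 m
  have hclose : ∀ x ∈ S, ∀ y ∈ T, ∀ n ≥ m, ∀ k ≥ m, |h n (x, y) - h k (x, y)| ≤ δ n + δ k := by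
    intro x hx y hy n hn k hk
    -- A product of positive-measure cells contains a point where all almost-everywhere bounds hold.
    -- Comparing both step values with `f` at that point gives a bound at every point of `S × T`.
    have hne : (μ.prod ν) ({z | a n z ≠ 0 ∧ a k z ≠ 0 ∧ a n z = a n x ∧ a k z = a k x} ×ˢ
        {z | b n z ≠ 0 ∧ b k z ≠ 0 ∧ b n z = b n y ∧ b k z = b k y}) ≠ 0 := by
      rw [Measure.prod_prod]
      exact mul_ne_zero (hScell x hx n hn k hk) (hTcell y hy n hn k hk)
    obtain ⟨p, ⟨⟨h1, h2, h3, h4⟩, ⟨h5, h6, h7, h8⟩⟩, hp⟩ :=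
      ((frequently_ae_mem_iff.2 hne).and_eventually hfc').exists
    have hn' := hp n h1 h5
    have hk' := hp k h2 h6
    have e1 : h n p = h n (x, y) := by simp only [h, h3, h7]
    have e2 : h k p = h k (x, y) := by simp only [h, h4, h8]
    rw [e1, abs_sub_comm] at hn'
    rw [e2] at hk'
    exact (abs_sub_le _ (f p) _).trans (add_le_add hn'.le hk'.le)
  have hlim : ∀ x ∈ S, ∀ y ∈ T, Tendsto (fun n => h n (x, y)) atTop (𝓝 (g (x, y))) := by
    intro x hx y hy
    refine tendsto_nhds_limUnder (cauchySeq_tendsto_of_complete (Metric.cauchySeq_iff'.2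
      fun e he => ?_))
    obtain ⟨K, hK⟩ := eventually_atTop.1 (hδ.eventually_lt_const (half_pos he))
    refine ⟨max K m, fun n hn => ?_⟩
    have h1 := hclose x hx y hy n ((le_max_right _ _).trans hn) _ (le_max_right K m)
    have h2 := hK n ((le_max_left _ _).trans hn)
    have h3 := hK _ (le_max_left K m)
    rw [Real.dist_eq]
    linarith
  have hgh : ∀ x ∈ S, ∀ y ∈ T, ∀ n ≥ m, |g (x, y) - h n (x, y)| ≤ δ n := by
    intro x hx y hy n hn
    have h1 : Tendsto (fun k => |h k (x, y) - h n (x, y)|) atTop (𝓝 |g (x, y) - h n (x, y)|) :=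
      ((hlim x hx y hy).sub_const _).abs
    have h2 : Tendsto (fun k => δ k + δ n) atTop (𝓝 (0 + δ n)) := hδ.add_const _
    rw [zero_add] at h2
    refine le_of_tendsto_of_tendsto h1 h2 ?_
    filter_upwards [eventually_ge_atTop m] with k hk using hclose x hx y hy k hk n hn
  have hmeasX : Measurable fun (x : S) n => a n x :=
    measurable_pi_iff.2 fun n => (ha n).comp measurable_subtype_coe
  have hmeasY : Measurable fun (y : T) n => b n y :=
    measurable_pi_iff.2 fun n => (hb n).comp measurable_subtype_coe
  have hreal : ∀ {t : ENNReal}, t ≤ ∑' k, η (k + m) → t.toReal ≤ ε := fun ht =>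
    ENNReal.toReal_le_of_le_ofReal hε.le (ht.trans hm)
  have hμ : 1 - ε ≤ μ.real S := by
    have h1 := probReal_compl_eq_one_sub (μ := μ) hS
    have h2 : μ.real Sᶜ ≤ ε := hreal hSμ
    linarith
  have hν : 1 - ε ≤ ν.real T := by
    have h1 := probReal_compl_eq_one_sub (μ := ν) hT
    have h2 : ν.real Tᶜ ≤ ε := hreal hTν
    linarith
  refine ⟨S, T, hS.nullMeasurableSet, hT.nullMeasurableSet, hμ, hν,
    pullbackSemimetric fun (x : S) n => a n x, pullbackSemimetric fun (y : T) n => b n y,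
    isAdmissible_pullbackSemimetric _ hmeasX, isAdmissible_pullbackSemimetric _ hmeasY, ?_⟩
  -- In these semimetrics every label is locally constant, so each step function is continuous.
  let : PseudoMetricSpace S := pullbackSemimetric fun (x : S) n => a n x
  let : PseudoMetricSpace T := pullbackSemimetric fun (y : T) n => b n y
  have hcx : ∀ n, Continuous fun x : S => a n x := fun n =>
    (continuous_apply n).comp (continuous_pullbackSemimetric fun (x : S) n => a n x)
  have hcy : ∀ n, Continuous fun y : T => b n y := fun n =>
    (continuous_apply n).comp (continuous_pullbackSemimetric fun (y : T) n => b n y)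
  have hch : ∀ n, Continuous fun p : S × T => h n (p.1, p.2) := fun n =>
    (continuous_of_discreteTopology (f := fun q : ℕ × ℕ => c n q.1 q.2)).comp
      (((hcx n).comp continuous_fst).prodMk ((hcy n).comp continuous_snd))
  have hunif : TendstoUniformly (fun n (p : S × T) => h n (p.1, p.2))
      (fun p => g (p.1, p.2)) atTop := by
    refine Metric.tendstoUniformly_iff.2 fun e he => ?_
    filter_upwards [hδ.eventually_lt_const he, eventually_ge_atTop m] with n hn hnm p
    rw [Real.dist_eq]
    exact (hgh _ p.1.2 _ p.2.2 n hnm).trans_lt hn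
  exact hunif.continuous (Eventually.of_forall hch).frequently

theorem virtuallyContinuous_of_labels {X Y : Type*} [MeasurableSpace X] [MeasurableSpace Y]
    {μ : Measure X} [IsProbabilityMeasure μ] {ν : Measure Y} [IsProbabilityMeasure ν]
    {f : X × Y → ℝ} (hf : AEMeasurable f (μ.prod ν))
    (h : ∀ ε : ℝ, 0 < ε → ∃ (N : ℕ) (a : X → Fin (N + 1)) (b : Y → Fin (N + 1)),
      Measurable a ∧ Measurable b ∧
      μ (a ⁻¹' {0}) ≤ ENNReal.ofReal ε ∧ ν (b ⁻¹' {0}) ≤ ENNReal.ofReal ε ∧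
      ∀ i ≠ 0, ∀ j ≠ 0, ∃ c : ℝ, ∀ᵐ p ∂μ.prod ν, a p.1 = i → b p.2 = j → |f p - c| < 2 * ε) :
    VirtuallyContinuous μ ν f := by
  -- Geometric scales make the exceptional measures summable, as Borel–Cantelli and the tail bounds
  -- need.
  choose N a b ha hb ha0 hb0 hab using fun n : ℕ => h ((1 / 2) ^ n) (by positivity)
  choose! c hc using hab
  have hs : Summable fun n : ℕ => (1 / 2 : ℝ) ^ n := summable_geometric_two
  refine virtuallyContinuous_of_step_approx hf (a := fun n x => a n x) (b := fun n y => b n y)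
    (δ := fun n => 2 * (1 / 2) ^ n) (η := fun n => ENNReal.ofReal ((1 / 2) ^ n))
    (fun n => measurable_from_top.comp (ha n)) (fun n => measurable_from_top.comp (hb n))
    (fun n i j => c n (Fin.ofNat _ i) (Fin.ofNat _ j)) hs.tsum_ofReal_ne_top ?_ ?_ ?_ fun n => ?_
  · refine fun n => (measure_mono fun x hx => ?_).trans (ha0 n)
    exact Fin.ext hx
  · refine fun n => (measure_mono fun x hx => ?_).trans (hb0 n)
    exact Fin.ext hx
  · simpa using hs.tendsto_atTop_zero.const_mul 2
  · have hall : ∀ᵐ p ∂μ.prod ν, ∀ i j, i ≠ 0 → j ≠ 0 → a n p.1 = i → b n p.2 = j →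
        |f p - c n i j| < 2 * (1 / 2) ^ n := by
      refine ae_all_iff.2 fun i => ae_all_iff.2 fun j => ?_
      by_cases hi : i = 0
      · simp [hi]
      by_cases hj : j = 0
      · simp [hj]
      filter_upwards [hc n i hi j hj] with p hp _ _ using hp
    filter_upwards [hall] with p hp hpa hpb
    simp only [Fin.ofNat_eq_cast, Fin.cast_val_eq_self]
    exact hp _ _ (fun h0 => hpa (by simp [h0])) (fun h0 => hpb (by simp [h0])) rfl rfl

theorem mainTheorem8 {X Y Ω : Type*}
    [MeasurableSpace X] [StandardBorelSpace X] [MeasurableSpace Y] [StandardBorelSpace Y]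
    (μ : Measure X) [IsProbabilityMeasure μ] [NullSingletonClass μ]
    (ν : Measure Y) [IsProbabilityMeasure ν] [NullSingletonClass ν]
    [MeasurableSpace Ω] (P : Measure Ω) [IsProbabilityMeasure P]
    (x : ℕ → Ω → X) (y : ℕ → Ω → Y)
    (hx : ∀ i, HasLaw (x i) μ P) (hy : ∀ j, HasLaw (y j) ν P)
    (hx_indep : iIndepFun x P) (hy_indep : iIndepFun y P)
    (hxy_indep : IndepFun (fun ω i => x i ω) (fun ω j => y j ω) P)
    (f : X × Y → ℝ) (hf : AEMeasurable f (μ.prod ν)) :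
    (VirtuallyContinuous μ ν f ↔
      ∀ ε : ℝ, 0 < ε → ∃ N : ℕ, 0 < N ∧
        Tendsto (fun n : ℕ => P {ω | FiniteBlockStructure ε N n
          (fun s t : Fin n => f (x s ω, y t ω))}) atTop (𝓝 1)) ∧
    (VirtuallyContinuous μ ν f ↔
      ∀ ε : ℝ, 0 < ε → ∃ N : ℕ, 0 < N ∧
        ∀ᵐ ω ∂P, InfiniteBlockStructure ε N (fun s t : ℕ => f (x s ω, y t ω))) := by
  have h₁ : VirtuallyContinuous μ ν f → ∀ ε : ℝ, 0 < ε → ∃ N : ℕ, 0 < N ∧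
      ∀ᵐ ω ∂P, InfiniteBlockStructure ε N (fun s t : ℕ => f (x s ω, y t ω)) :=
    fun h ε hε => h.ae_infiniteBlockStructure hx hy hx_indep hy_indep hxy_indep hε
  have h₂ : (∀ ε : ℝ, 0 < ε → ∃ N : ℕ, 0 < N ∧
      ∀ᵐ ω ∂P, InfiniteBlockStructure ε N (fun s t : ℕ => f (x s ω, y t ω))) →
      ∀ ε : ℝ, 0 < ε → ∃ N : ℕ, 0 < N ∧
        Tendsto (fun n : ℕ => P {ω | FiniteBlockStructure ε N n
          (fun s t : Fin n => f (x s ω, y t ω))}) atTop (𝓝 1) := fun h ε hε => by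
    obtain ⟨N, hN, hae⟩ := h ε hε
    exact ⟨N, hN, tendsto_finiteBlockStructure_of_ae hae⟩
  have h₃ : (∀ ε : ℝ, 0 < ε → ∃ N : ℕ, 0 < N ∧
      Tendsto (fun n : ℕ => P {ω | FiniteBlockStructure ε N n
        (fun s t : Fin n => f (x s ω, y t ω))}) atTop (𝓝 1)) → VirtuallyContinuous μ ν f :=
    fun h => virtuallyContinuous_of_labels hf fun ε hε => by
      obtain ⟨N, -, hN⟩ := h ε hε
      exact ⟨N, exists_labels_of_tendsto hx hy hx_indep hy_indep hxy_indep hf hε hN⟩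
  exact ⟨⟨fun h => h₂ (h₁ h), h₃⟩, ⟨h₁, fun h => h₃ (h₂ h)⟩⟩
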